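/- Let $\overline{\mathbb Q}$ be an algebraic closure of $\mathbb Q$, and let $h$ be the absolute logarithmic Weil height on $\overline{\mathbb Q}$: if $L$ is a number field containing $\beta$, then $h(\beta)=\sum_v \frac{[L_v:\mathbb Q_v]}{[L:\mathbb Q]}\log\max\{1,\|\beta\|_v\}$, where $v$ runs over all places of $L$ and $\|\cdot\|_v$ extends the usual absolute value ($p$-adic or Archimedean) on $\mathbb Q$; this does not depend on $L$, and $h(0)=0$. For a number field $K\subseteq\overline{\mathbb Q}$ and $\beta\in\overline{\mathbb Q}$ put $m_K(\beta)=[K(\beta):K]\cdot h(\beta)$. For $\alpha\in\overline{\mathbb Q}$ and real $t>0$ define $$m_{K,t}(\alpha)=\inf\left\{\left(\sum_{n=1}^N m_K(\alpha_n)^t\right)^{1/t} : N\ge 1,\ \alpha_1,\dots,\alpha_N\in\overline{\mathbb Q},\ \alpha=\alpha_1\alpha_2\cdots\alpha_N\right\},$$ $$m_{K,\infty}(\alpha)=\inf\left\{\max_{1\le n\le N} m_K(\alpha_n) : N\ge 1,\ \alpha_1,\dots,\alpha_N\in\overline{\mathbb Q},\ \alpha=\alpha_1\alpha_2\cdots\alpha_N\right\}.$$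 **Corollary 1.3.** Suppose that $K=\mathbb Q$ or that $K$ is an imaginary quadratic extension of $\mathbb Q$ of class number $1$, and let $\alpha\in K$. For every real $t>0$ there exist $N\ge 1$ and points $\alpha_1,\alpha_2,\dots,\alpha_N\in K$ such that $\alpha=\alpha_1\alpha_2\cdots\alpha_N$ and $$m_{K,t}(\alpha)^t=\sum_{n=1}^N m_K(\alpha_n)^t.$$ Similarly, there exist $N\ge 1$ and $\alpha_1,\alpha_2,\dots,\alpha_N\in K$ such that $\alpha=\alpha_1\alpha_2\cdots\alpha_N$ and $m_{K,\infty}(\alpha)=\max\{m_K(\alpha_n):1\le n\le N\}$. -/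

import Mathlib

namespace MetricMahler

/-- The Mahler measure of `β` over `K`: `m_K(β) = [K(β) : K] · h(β)`, where `h` is Mathlib's
absolute logarithmic Weil height of an algebraic number (in particular `m_K(0) = 0`). -/
noncomputable def mahlerOver (K : Type*) {Qbar : Type*} [Field K] [Field Qbar] [CharZero Qbar]
    [Algebra K Qbar] (β : Qbar) : ℝ :=
  (Module.finrank K (IntermediateField.adjoin K {β}) : ℝ) * NumberField.absLogHeight₁ β

/-- The `t`-metric Mahler measure of `α` over `K` for `0 < t < ∞`: the infimum of
`(∑ m_K(α_n) ^ t) ^ (1 / t)` over all factorizations `α = α_1 ⋯ α_N`, `N ≥ 1`, in `Qbar`. -/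
noncomputable def metricMahler (K : Type*) {Qbar : Type*} [Field K] [Field Qbar] [CharZero Qbar]
    [Algebra K Qbar] (t : ℝ) (α : Qbar) : ℝ :=
  sInf {x : ℝ | ∃ N : ℕ, 0 < N ∧ ∃ a : Fin N → Qbar,
    α = ∏ n, a n ∧ x = (∑ n, mahlerOver K (a n) ^ t) ^ (1 / t)}

/-- The `∞`-metric Mahler measure of `α` over `K`: the infimum of `max m_K(α_n)` over all
factorizations `α = α_1 ⋯ α_N`, `N ≥ 1`, in `Qbar`. -/
noncomputable def metricMahlerInf (K : Type*) {Qbar : Type*} [Field K] [Field Qbar]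
    [CharZero Qbar] [Algebra K Qbar] (α : Qbar) : ℝ :=
  sInf {x : ℝ | ∃ N : ℕ, 0 < N ∧ ∃ a : Fin N → Qbar,
    α = ∏ n, a n ∧ x = ⨆ n, mahlerOver K (a n)}

end MetricMahler

/-! Given `α = ∏ a n` with `α ≠ 0`, take norms to `K` from a field containing all `a n`: this gives
`α ^ D = ∏ β n ^ e n` with `e n ≤ D`, where `β n` is the norm of `a n` from `K(a n)`. Norms do not
raise the height relative to the field (`mulHeight₁_norm_le`), so `m_K(β n) ≤ m_K(a n)`. The
hypotheses on `K` give unique factorization and a single infinite place. Write `α = A / B` in lowest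
terms; the primes of `A` and `B` can be distributed among the numerators and denominators of the `β
n`. Nonzero integers have absolute value at least 1, so passing to divisors in a reduced fraction
cannot raise its height (`exists_factors_distributing`). Hence every factorization is matched or
beaten by a grouping of the prime factors of `α`. There are finitely many groupings, so the infimum
is attained. -/

open NumberField Height IntermediateField

namespace NumberField

/-! ### Products over complex embeddings in an extension. -/

section Embeddings

variable {F L : Type*} [Field F] [NumberField F] [Field L] [NumberField L] [Algebra F L]

lemma InfinitePlace.prod_pow_mult_eq_prod_embeddings {M : Type*} [CommMonoid M]
    (f : InfinitePlace F → M) :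
    ∏ v : InfinitePlace F, f v ^ v.mult = ∏ φ : F →+* ℂ, f (InfinitePlace.mk φ) := by
  classical
  rw [← Finset.prod_fiberwise Finset.univ InfinitePlace.mk (fun φ => f (InfinitePlace.mk φ))]
  refine Finset.prod_congr rfl fun w _ ↦ ?_
  rw [Finset.prod_congr rfl (g := fun _ ↦ f w) fun φ hφ ↦ by rw [(Finset.mem_filter.mp hφ).2],
    Finset.prod_const, InfinitePlace.card_filter_mk_eq]

/-- Bounding a product over the embeddings of `L` by comparing, for each embedding of `F`,
with the product over its extensions to `L`. -/
lemma prod_embeddings_le_prod_embeddings (g : (F →+* ℂ) → ℝ) (f : (L →+* ℂ) → ℝ)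
    (hg : ∀ φ, 0 ≤ g φ)
    (h : ∀ φ : F →+* ℂ, letI := φ.toAlgebra
      g φ ≤ ∏ σ : L →ₐ[F] ℂ, f σ) :
    ∏ φ, g φ ≤ ∏ ψ, f ψ := by
  classical
  rw [← Finset.prod_fiberwise Finset.univ (fun ψ : L →+* ℂ ↦ ψ.comp (algebraMap F L)) f]
  refine Finset.prod_le_prod (fun φ _ ↦ hg φ) fun φ _ ↦ (h φ).trans_eq ?_
  let := φ.toAlgebra
  refine Finset.prod_bij (fun σ _ ↦ (σ : L →+* ℂ)) (fun σ _ ↦ ?_) (fun σ _ τ _ hst ↦ ?_)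
    (fun ψ hψ ↦ ?_) (fun _ _ ↦ rfl)
  · simp only [Finset.mem_filter_univ]
    exact σ.comp_algebraMap
  · exact AlgHom.coe_ringHom_injective hst
  · simp only [Finset.mem_filter_univ] at hψ
    exact ⟨⟨ψ, fun r ↦ RingHom.congr_fun hψ r⟩, Finset.mem_univ _, rfl⟩

lemma prod_embeddings_comp_algebraMap (g : (F →+* ℂ) → ℝ) :
    ∏ ψ : L →+* ℂ, g (ψ.comp (algebraMap F L)) = (∏ φ, g φ) ^ Module.finrank F L := by
  classical
  rw [← Finset.prod_pow, ← Finset.prod_fiberwise Finset.univ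
    (fun ψ : L →+* ℂ ↦ ψ.comp (algebraMap F L)) (fun ψ ↦ g (ψ.comp (algebraMap F L)))]
  refine Finset.prod_congr rfl fun φ _ ↦ ?_
  rw [Finset.prod_congr rfl (g := fun _ ↦ g φ) fun φ hφ ↦ by rw [(Finset.mem_filter.mp hφ).2],
    Finset.prod_const]
  congr 1
  let := φ.toAlgebra
  have := Algebra.IsAlgebraic.of_finite F L
  rw [← AlgHom.card F L ℂ, ← Finset.card_univ]
  symm
  refine Finset.card_bij (fun σ _ ↦ (σ : L →+* ℂ)) (fun σ _ ↦ ?_) (fun σ _ τ _ hst ↦ ?_)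
    (fun ψ hψ ↦ ?_)
  · simp only [Finset.mem_filter_univ]
    exact σ.comp_algebraMap
  · exact AlgHom.coe_ringHom_injective hst
  · simp only [Finset.mem_filter_univ] at hψ
    exact ⟨⟨ψ, fun r ↦ RingHom.congr_fun hψ r⟩, Finset.mem_univ _, rfl⟩

end Embeddings

/-! ### Heights under field extension and norm. -/

section Height

variable {F : Type*} [Field F] [NumberField F]

/-- The finite places contribute exactly the inverse of the ideal norm, so heights can be compared
through ideals and embeddings, without tracking finite places in extensions. -/
lemma mulHeight₁_div_mul_absNorm (a b : 𝓞 F) (hb : b ≠ 0) :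
    mulHeight₁ (a / b : F) * (Ideal.span {a, b}).absNorm =
      ∏ φ : F →+* ℂ, max ‖φ a‖ ‖φ b‖ := by
  have hb' : (b : F) ≠ 0 := by simpa using hb
  have h1 : ![(a : F), (b : F)] ≠ 0 := fun h ↦ hb' (by simpa using congrFun h 1)
  have h2 : ![a, b] ≠ 0 := fun h ↦ hb (by simpa using congrFun h 1)
  have h3 := absNorm_mul_finprod_finitePlace_eq_one h2
  have h4 (v : FinitePlace F) : ⨆ i, v (![a, b] i : F) = ⨆ i, v (![(a : F), b] i) := by
    congr 1; ext i; fin_cases i <;> rfl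
  simp_rw [h4] at h3
  have h5 : Set.range ![a, b] = {a, b} := by simp [Set.pair_comm]
  rw [h5] at h3
  rw [mulHeight₁_div_eq_mulHeight, NumberField.mulHeight_eq h1, mul_assoc,
    mul_comm (finprod _), h3, mul_one,
    InfinitePlace.prod_pow_mult_eq_prod_embeddings (fun v ↦ ⨆ i, v (![(a : F), b] i))]
  refine Finset.prod_congr rfl fun φ _ ↦ ?_
  refine le_antisymm (ciSup_le fun i ↦ ?_) (max_le ?_ ?_)
  · fin_cases i <;> simp [InfinitePlace.apply]
  · exact Finite.le_ciSup_of_le 0 (by simp [InfinitePlace.apply])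
  · exact Finite.le_ciSup_of_le 1 (by simp [InfinitePlace.apply])

lemma absNorm_span_pair_ne_zero (a b : 𝓞 F) (hb : b ≠ 0) :
    ((Ideal.span {a, b}).absNorm : ℝ) ≠ 0 := by
  rw [Nat.cast_ne_zero, Ne, Ideal.absNorm_eq_zero_iff, Ideal.span_eq_bot]
  intro h
  exact hb (h b (by simp))

variable {L : Type*} [Field L] [NumberField L] [Algebra F L]

/-- Both the norm of an extended ideal and the product over embeddings are raised to the power `[L :
F]`. -/
theorem mulHeight₁_algebraMap (x : F) :
    mulHeight₁ (algebraMap F L x) = mulHeight₁ x ^ Module.finrank F L := by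
  obtain ⟨a, b, hb, rfl⟩ := IsFractionRing.div_surjective (A := 𝓞 F) x
  have hb : b ≠ 0 := nonZeroDivisors.ne_zero hb
  have hb' : algebraMap (𝓞 F) (𝓞 L) b ≠ 0 := by
    simpa [FaithfulSMul.algebraMap_eq_zero_iff] using hb
  have hF := mulHeight₁_div_mul_absNorm a b hb
  have hL := mulHeight₁_div_mul_absNorm (algebraMap (𝓞 F) (𝓞 L) a) (algebraMap (𝓞 F) (𝓞 L) b) hb'
  have hN : (Ideal.span {algebraMap (𝓞 F) (𝓞 L) a, algebraMap (𝓞 F) (𝓞 L) b}).absNorm =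
      (Ideal.span {a, b}).absNorm ^ Module.finrank F L := by
    have := Ideal.absNorm_algebraMap (R := 𝓞 F) (𝓞 L) (Ideal.span {a, b})
    rw [Ideal.map_span, Set.image_pair] at this
    rw [this, ← IsFractionRing.finrank_eq (𝓞 F) F (𝓞 L) L]
  have h := prod_embeddings_comp_algebraMap (L := L) (fun φ : F →+* ℂ ↦ max ‖φ a‖ ‖φ b‖)
  rw [← hF, mul_pow] at h
  have h' : mulHeight₁ (algebraMap F L (algebraMap (𝓞 F) F a / algebraMap (𝓞 F) F b)) *
      ((Ideal.span {a, b}).absNorm : ℝ) ^ Module.finrank F L =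
      mulHeight₁ (algebraMap (𝓞 F) F a / algebraMap (𝓞 F) F b) ^ Module.finrank F L *
      ((Ideal.span {a, b}).absNorm : ℝ) ^ Module.finrank F L := by
    refine Eq.trans ?_ h
    rw [hN] at hL
    push_cast at hL
    rw [map_div₀]
    exact hL
  exact mul_right_cancel₀ (pow_ne_zero _ (absNorm_span_pair_ne_zero a b hb)) h'

/-- At each embedding of `F`, a maximum of two products is at most the product of the maxima. On the
finite side, `(N a, n ^ d)` lies in the relative norm of `(a, n)`, so its absolute norm is at least
as large. -/
theorem mulHeight₁_norm_le (x : L) : mulHeight₁ (Algebra.norm F x) ≤ mulHeight₁ x := by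
  -- A rational integer as denominator has norm simply `n ^ d`.
  obtain ⟨n, hn, a, ha, -⟩ := exists_nat_ne_zero_exists_integer_mul_eq_and_absNorm_span_eq_pow x
  set d := Module.finrank F L
  have hnL : ((n : 𝓞 L) : L) = n := by simp
  have hnL0 : (n : L) ≠ 0 := by exact_mod_cast hn
  have hx : x = a / (n : 𝓞 L) := by rw [hnL, eq_div_iff hnL0, mul_comm, ha]
  have hb : (n : 𝓞 L) ≠ 0 := by exact_mod_cast hn
  have hb' : ((n : 𝓞 F) ^ d) ≠ 0 := pow_ne_zero _ (by exact_mod_cast hn)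
  have hL := mulHeight₁_div_mul_absNorm a _ hb
  have hF := mulHeight₁_div_mul_absNorm (Algebra.intNorm (𝓞 F) (𝓞 L) a) _ hb'
  have hna : ((Algebra.intNorm (𝓞 F) (𝓞 L) a : 𝓞 F) : F) = Algebra.norm F (a : L) :=
    Algebra.algebraMap_intNorm (A := 𝓞 F) (K := F) (L := L) (B := 𝓞 L) a
  have hnn : Algebra.intNorm (𝓞 F) (𝓞 L) (n : 𝓞 L) = (n : 𝓞 F) ^ d := by
    apply RingOfIntegers.ext
    have := Algebra.algebraMap_intNorm (A := 𝓞 F) (K := F) (L := L) (B := 𝓞 L) (n : 𝓞 L)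
    refine this.trans ?_
    have h2 : algebraMap (𝓞 L) L (n : 𝓞 L) = algebraMap F L (n : F) := by simp
    rw [h2, Algebra.norm_algebraMap]
    simp [d]
  have hnx : Algebra.norm F x = (Algebra.intNorm (𝓞 F) (𝓞 L) a : 𝓞 F) / ((n : 𝓞 F) ^ d : 𝓞 F) := by
    have h2 : (n : L) = algebraMap F L (n : F) := by simp
    rw [eq_div_iff (by simpa using hb'), hna, ← ha, map_mul, h2, Algebra.norm_algebraMap, mul_comm]
    simp [d]
  have hle : Ideal.span {Algebra.intNorm (𝓞 F) (𝓞 L) a, (n : 𝓞 F) ^ d} ≤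
      Ideal.relNorm (𝓞 F) (Ideal.span {a, (n : 𝓞 L)}) := by
    rw [← hnn, Ideal.span_le, Ideal.relNorm_apply]
    rintro _ (rfl | rfl)
    · exact Ideal.subset_span ⟨a, Ideal.subset_span (by simp), rfl⟩
    · exact Ideal.subset_span ⟨_, Ideal.subset_span (by simp), rfl⟩
  have hnorm : ((Ideal.span {a, (n : 𝓞 L)}).absNorm : ℝ) ≤
      (Ideal.span {Algebra.intNorm (𝓞 F) (𝓞 L) a, (n : 𝓞 F) ^ d}).absNorm := by
    have := Ideal.absNorm_dvd_absNorm_of_le hle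
    rw [Ideal.absNorm_relNorm] at this
    exact_mod_cast Nat.le_of_dvd
      (Nat.pos_of_ne_zero (by exact_mod_cast absNorm_span_pair_ne_zero _ _ hb')) this
  have hprod : (∏ φ : F →+* ℂ, max ‖φ (Algebra.intNorm (𝓞 F) (𝓞 L) a : 𝓞 F)‖
      ‖φ ((n : 𝓞 F) ^ d : 𝓞 F)‖) ≤
      ∏ ψ : L →+* ℂ, max ‖ψ a‖ ‖ψ (n : 𝓞 L)‖ := by
    refine prod_embeddings_le_prod_embeddings _ _ (fun _ ↦ by positivity) fun φ ↦ ?_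
    let := φ.toAlgebra
    refine max_le ?_ ?_
    · rw [hna]
      change ‖algebraMap F ℂ _‖ ≤ _
      rw [Algebra.norm_eq_prod_embeddings, norm_prod]
      exact Finset.prod_le_prod (fun _ _ ↦ norm_nonneg _) fun _ _ ↦ le_max_left _ _
    · have : ‖φ ((n : 𝓞 F) ^ d : 𝓞 F)‖ = ∏ σ : L →ₐ[F] ℂ, ‖σ (n : 𝓞 L)‖ := by
        have := Algebra.IsAlgebraic.of_finite F L
        simp only [map_natCast, map_pow, norm_pow, Finset.prod_const, Finset.card_univ,
          AlgHom.card F L ℂ, d]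
      rw [this]
      exact Finset.prod_le_prod (fun _ _ ↦ norm_nonneg _) fun _ _ ↦ le_max_right _ _
  rw [← hL, ← hF, ← hnx, ← hx] at hprod
  have hpos : (0 : ℝ) < (Ideal.span {a, (n : 𝓞 L)}).absNorm :=
    lt_of_le_of_ne (Nat.cast_nonneg _) (absNorm_span_pair_ne_zero _ _ hb).symm
  refine le_of_mul_le_mul_right (le_trans ?_ hprod) hpos
  exact mul_le_mul_of_nonneg_left hnorm (mulHeight₁_nonneg _)

/-- The absolute height is computed in `ℚ(i x)`, which embeds back into `F` by sending `i x` to `x`;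
the extension formula does the rest. -/
theorem finrank_mul_absLogHeight₁ {E : Type*} [Field E] [CharZero E] (i : F →+* E) (x : F) :
    Module.finrank ℚ F * absLogHeight₁ (i x) = logHeight₁ x := by
  have hx : IsIntegral ℚ x := Algebra.IsIntegral.isIntegral x
  let i' : F →ₐ[ℚ] E := i.toRatAlgHom
  have hix : IsIntegral ℚ (i x) := hx.map i'
  have : FiniteDimensional ℚ ℚ⟮i x⟯ := adjoin.finiteDimensional hix
  have : NumberField ℚ⟮i x⟯ := {}
  have hroot : x ∈ (minpoly ℚ (i x)).aroots F := by
    rw [Polynomial.mem_aroots]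
    refine ⟨minpoly.ne_zero hix, ?_⟩
    have : minpoly ℚ (i x) = minpoly ℚ x := minpoly.algHom_eq i' i'.injective x
    rw [this, minpoly.aeval]
  let ρ : ℚ⟮i x⟯ →ₐ[ℚ] F := (algHomAdjoinIntegralEquiv ℚ hix).symm ⟨x, hroot⟩
  have hρ : ρ (AdjoinSimple.gen ℚ (i x)) = x := algHomAdjoinIntegralEquiv_symm_apply_gen ℚ hix _
  let := ρ.toRingHom.toAlgebra
  have h := mulHeight₁_algebraMap (L := F) (AdjoinSimple.gen ℚ (i x))
  have hρ' : algebraMap ℚ⟮i x⟯ F (AdjoinSimple.gen ℚ (i x)) = x := hρ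
  rw [hρ'] at h
  have htower : Module.finrank ℚ ℚ⟮i x⟯ * Module.finrank ℚ⟮i x⟯ F = Module.finrank ℚ F :=
    Module.finrank_mul_finrank ℚ ℚ⟮i x⟯ F
  have hne : (Module.finrank ℚ ℚ⟮i x⟯ : ℝ) ≠ 0 := by
    exact_mod_cast (Module.finrank_pos (R := ℚ) (M := ℚ⟮i x⟯)).ne'
  rw [logHeight₁_eq_log_mulHeight₁, h, Real.log_pow, absLogHeight₁, absMulHeight₁, dif_pos hix,
    Real.log_rpow (mulHeight₁_pos _), ← htower]
  push_cast
  field_simp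

end Height

end NumberField

/-! ### Distributing primes over a product. -/

section Divisibility

/-- Induction on `s`: a prime divides some `c m`; assign it to `m` and cancel it there. -/
lemma exists_partition_of_prod_prime_dvd_prod {R : Type*} [CommMonoidWithZero R]
    [IsCancelMulZero R] {ι κ : Type*} [Fintype κ] [Nonempty κ] [DecidableEq κ] (s : Finset ι)
    (p : ι → R) (hp : ∀ i, Prime (p i)) (c : κ → R) (h : ∏ i ∈ s, p i ∣ ∏ n, c n) :
    ∃ f : ι → κ, ∀ n, ∏ i ∈ s with f i = n, p i ∣ c n := by
  classical
  induction s using Finset.induction_on generalizing c with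
  | empty => exact ⟨fun _ ↦ Classical.arbitrary κ, fun n ↦ by simp⟩
  | insert j s hj ih =>
    rw [Finset.prod_insert hj] at h
    obtain ⟨m, -, hm⟩ := (hp j).exists_mem_finset_dvd (dvd_of_mul_right_dvd h)
    obtain ⟨e, he⟩ := hm
    have hc : ∏ n, c n = p j * ∏ n, Function.update c m e n := by
      rw [← Finset.mul_prod_erase _ _ (Finset.mem_univ m), he,
        ← Finset.mul_prod_erase _ (Function.update c m e) (Finset.mem_univ m),
        Function.update_self, mul_assoc]
      congr 2
      exact Finset.prod_congr rfl fun n hn ↦ by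
        rw [Function.update_of_ne (Finset.ne_of_mem_erase hn)]
    rw [hc, mul_dvd_mul_iff_left (hp j).ne_zero] at h
    obtain ⟨f, hf⟩ := ih _ h
    refine ⟨Function.update f j m, fun n ↦ ?_⟩
    have hs : ∏ i ∈ s with Function.update f j m i = n, p i = ∏ i ∈ s with f i = n, p i := by
      refine Finset.prod_congr (Finset.filter_congr fun i hi ↦ ?_) fun _ _ ↦ rfl
      rw [Function.update_of_ne (ne_of_mem_of_not_mem hi hj)]
    rw [Finset.filter_insert, Function.update_self]
    split_ifs with hmn
    · subst hmn
      rw [Finset.prod_insert (by simp [hj]), hs, he]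
      exact mul_dvd_mul_left _ (by simpa using hf m)
    · rw [hs]
      simpa [Function.update_of_ne (Ne.symm hmn)] using hf n

/-- By coprimality `A ^ D` divides `∏ a n ^ e n`, hence `(∏ a n) ^ D` because `e n ≤ D`; unique
factorization removes the exponent. -/
lemma IsRelPrime.dvd_prod_of_pow_mul_eq {R : Type*} [CommRing R] [IsDomain R]
    [UniqueFactorizationMonoid R] {κ : Type*} [Fintype κ] {A B X : R} {D : ℕ} (hD : D ≠ 0)
    (hAB : IsRelPrime A B) (a : κ → R) (e : κ → ℕ) (he : ∀ n, e n ≤ D)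
    (h : A ^ D * X = B ^ D * ∏ n, a n ^ e n) : A ∣ ∏ n, a n := by
  have h1 : A ^ D ∣ ∏ n, a n ^ e n := (hAB.pow (m := D) (n := D)).dvd_of_dvd_mul_left ⟨X, h.symm⟩
  have h2 : A ^ D ∣ (∏ n, a n) ^ D := by
    rw [← Finset.prod_pow]
    exact h1.trans (Finset.prod_dvd_prod_of_dvd _ _ fun n _ ↦ pow_dvd_pow _ (he n))
  exact (UniqueFactorizationMonoid.pow_dvd_pow_iff_dvd hD).1 h2

lemma UniqueFactorizationMonoid.exists_fin_prod_prime {R : Type*} [CommMonoidWithZero R]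
    [UniqueFactorizationMonoid R] {a : R} (ha : a ≠ 0) :
    ∃ (r : ℕ) (p : Fin r → R) (u : Rˣ), (∀ i, Prime (p i)) ∧ a = u * ∏ i, p i := by
  obtain ⟨s, hs, u, hu⟩ := UniqueFactorizationMonoid.exists_prime_factors a ha
  refine ⟨s.toList.length, fun i ↦ s.toList[i.1], u, fun i ↦ ?_, ?_⟩
  · exact hs _ (Multiset.mem_toList.1 (List.getElem_mem _))
  · rw [Fin.prod_univ_getElem, Multiset.prod_toList, mul_comm, hu]

end Divisibility

namespace NumberField

variable {K : Type*} [Field K] [NumberField K]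

/-! ### Fields with one infinite place and principal ring of integers. -/

section OneInfinitePlace

variable [Subsingleton (InfinitePlace K)]

lemma one_le_norm_embedding (φ : K →+* ℂ) {e : 𝓞 K} (he : e ≠ 0) : 1 ≤ ‖φ e‖ := by
  rw [← InfinitePlace.apply]
  -- Being small at all other infinite places is a vacuous condition here.
  exact InfinitePlace.one_le_of_lt_one he fun z hz ↦ absurd (Subsingleton.elim _ _) hz

lemma norm_embedding_le_of_dvd (φ : K →+* ℂ) {a c : 𝓞 K} (ha : a ≠ 0) (h : c ∣ a) :
    ‖φ c‖ ≤ ‖φ a‖ := by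
  obtain ⟨e, rfl⟩ := h
  have h : φ (c * e : 𝓞 K) = φ c * φ e := by simp
  rw [h, norm_mul]
  exact le_mul_of_one_le_right (norm_nonneg _) (one_le_norm_embedding φ (right_ne_zero_of_mul ha))

lemma norm_embedding_unit (φ : K →+* ℂ) (u : (𝓞 K)ˣ) : ‖φ (u : 𝓞 K)‖ = 1 := by
  refine le_antisymm ?_ (one_le_norm_embedding φ u.ne_zero)
  have := norm_embedding_le_of_dvd φ one_ne_zero (u.isUnit.dvd (a := (1 : 𝓞 K)))
  simpa using this

variable [IsPrincipalIdealRing (𝓞 K)]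

omit [Subsingleton (InfinitePlace K)] in
lemma mulHeight₁_div_of_isRelPrime {a b : 𝓞 K} (hb : b ≠ 0) (h : IsRelPrime a b) :
    mulHeight₁ (a / b : K) = ∏ φ : K →+* ℂ, max ‖φ a‖ ‖φ b‖ := by
  have h1 := mulHeight₁_div_mul_absNorm a b hb
  have h2 : Ideal.span {a, b} = ⊤ := by
    rw [Ideal.span_insert, ← Ideal.isCoprime_iff_sup_eq, Ideal.isCoprime_span_singleton_iff,
      ← isRelPrime_iff_isCoprime]
    exact h
  rwa [h2, Ideal.absNorm_top, Nat.cast_one, mul_one] at h1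

/-- For coprime pairs the ideal factor is trivial, leaving only the embeddings, where divisors are
no larger. -/
lemma mulHeight₁_div_le_of_dvd {a b c d : 𝓞 K} (ha : a ≠ 0) (hb : b ≠ 0) (h : IsRelPrime a b)
    (hca : c ∣ a) (hdb : d ∣ b) : mulHeight₁ (c / d : K) ≤ mulHeight₁ (a / b : K) := by
  rw [mulHeight₁_div_of_isRelPrime hb h, mulHeight₁_div_of_isRelPrime
    (ne_zero_of_dvd_ne_zero hb hdb) ((h.of_dvd_left hca).of_dvd_right hdb)]
  exact Finset.prod_le_prod (fun _ _ ↦ by positivity) fun φ _ ↦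
    max_le_max (norm_embedding_le_of_dvd φ ha hca) (norm_embedding_le_of_dvd φ hb hdb)

lemma logHeight₁_unit_div (u v : (𝓞 K)ˣ) : logHeight₁ ((u : 𝓞 K) / (v : 𝓞 K) : K) = 0 := by
  rw [logHeight₁_eq_log_mulHeight₁,
    mulHeight₁_div_of_isRelPrime v.ne_zero (u.isUnit.isRelPrime_left)]
  simp [norm_embedding_unit]

/-- Every nonzero `α` splits into an element of height zero and finitely many factors that can be
distributed over any multiplicative decomposition of a power of `α` without raising heights. -/
lemma exists_factors_distributing {α : K} (hα : α ≠ 0) :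
    ∃ (ι : Type) (_ : Fintype ι) (x : ι → K) (u : K), α = u * ∏ i, x i ∧ logHeight₁ u = 0 ∧
      ∀ (N : ℕ) (_ : 0 < N) (β : Fin N → K) (e : Fin N → ℕ) (D : ℕ), D ≠ 0 → (∀ n, e n ≤ D) →
        (∀ n, β n ≠ 0) → α ^ D = ∏ n, β n ^ e n →
        ∃ f : ι → Fin N, ∀ n, logHeight₁ (∏ i with f i = n, x i) ≤ logHeight₁ (β n) := by
  classical
  have frac (γ : K) (hγ : γ ≠ 0) : ∃ a b : 𝓞 K, a ≠ 0 ∧ b ≠ 0 ∧ IsRelPrime a b ∧ γ = a / b := by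
    obtain ⟨a, b, hab, h⟩ := IsFractionRing.exists_reduced_fraction (A := 𝓞 K) γ
    have h' : γ = a / (b : 𝓞 K) := by rw [← h, IsFractionRing.mk'_eq_div]
    refine ⟨a, b, ?_, nonZeroDivisors.coe_ne_zero b, hab, h'⟩
    rintro rfl
    exact hγ (by simp [h'])
  obtain ⟨A, B, hA, hB, hAB, rfl⟩ := frac α hα
  obtain ⟨r, p, u, hp, hpA⟩ := UniqueFactorizationMonoid.exists_fin_prod_prime hA
  obtain ⟨s, q, v, hq, hqB⟩ := UniqueFactorizationMonoid.exists_fin_prod_prime hB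
  refine ⟨Fin r ⊕ Fin s, inferInstance,
    Sum.elim (fun i ↦ (p i : K)) (fun j ↦ (q j : K)⁻¹), (u : 𝓞 K) / (v : 𝓞 K), ?_,
    logHeight₁_unit_div u v, fun N hN β e D hD he hβ h ↦ ?_⟩
  · conv_lhs => rw [hpA, hqB]
    simp [div_eq_mul_inv, map_prod]
    ring
  · have : Nonempty (Fin N) := ⟨⟨0, hN⟩⟩
    choose a b ha hb hab hβ using fun n ↦ frac (β n) (hβ n)
    have hB' : (B : K) ≠ 0 := by simpa using hB
    have hb' : ∏ n, (b n : K) ^ e n ≠ 0 :=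
      Finset.prod_ne_zero_iff.2 fun n _ ↦ pow_ne_zero _ (by simpa using hb n)
    have key : A ^ D * ∏ n, b n ^ e n = B ^ D * ∏ n, a n ^ e n := by
      apply RingOfIntegers.ext
      simp only [hβ, div_pow, Finset.prod_div_distrib] at h
      rw [div_eq_div_iff (pow_ne_zero _ hB') hb'] at h
      push_cast [map_prod]
      simpa [map_prod, mul_comm] using h
    have hdA : ∏ i, p i ∣ ∏ n, a n :=
      (Dvd.intro_left _ hpA.symm).trans (hAB.dvd_prod_of_pow_mul_eq hD a e he key)
    have hdB : ∏ j, q j ∣ ∏ n, b n :=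
      (Dvd.intro_left _ hqB.symm).trans (hAB.symm.dvd_prod_of_pow_mul_eq hD b e he key.symm)
    obtain ⟨f, hf⟩ := exists_partition_of_prod_prime_dvd_prod _ p hp a hdA
    obtain ⟨g, hg⟩ := exists_partition_of_prod_prime_dvd_prod _ q hq b hdB
    refine ⟨Sum.elim f g, fun n ↦ ?_⟩
    have hx : ∏ i with Sum.elim f g i = n,
        Sum.elim (fun i ↦ (p i : K)) (fun j ↦ (q j : K)⁻¹) i =
        ((∏ i with f i = n, p i : 𝓞 K) : K) / ((∏ j with g j = n, q j : 𝓞 K) : K) := by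
      simp only [map_prod]
      rw [div_eq_mul_inv, ← Finset.prod_inv_distrib, Finset.prod_filter,
        Finset.prod_filter, Finset.prod_filter, Fintype.prod_sum_type]
      rfl
    rw [hx, hβ n, logHeight₁_eq_log_mulHeight₁, logHeight₁_eq_log_mulHeight₁]
    exact Real.log_le_log (mulHeight₁_pos _)
      (mulHeight₁_div_le_of_dvd (ha n) (hb n) (hab n) (hf n) (hg n))

end OneInfinitePlace

end NumberField

namespace MetricMahler

/-! ### Descent of factorizations to `K` by norms. -/

section Basic

variable {K E : Type*} [Field K] [NumberField K] [Field E] [CharZero E] [Algebra K E]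

lemma mahlerOver_eq_logHeight₁_div {L : Type*} [Field L] [NumberField L] [Algebra K L]
    [Algebra L E] [IsScalarTower K L E] (y : L) :
    mahlerOver K (algebraMap L E y) =
      Module.finrank K K⟮y⟯ * (logHeight₁ y / Module.finrank ℚ L) := by
  have hy : IsIntegral K y := Algebra.IsIntegral.isIntegral y
  have hL : (Module.finrank ℚ L : ℝ) ≠ 0 := by
    exact_mod_cast (Module.finrank_pos (R := ℚ) (M := L)).ne'
  rw [mahlerOver, ← finrank_mul_absLogHeight₁ (algebraMap L E) y, mul_div_cancel_left₀ _ hL,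
    adjoin.finrank hy, adjoin.finrank (hy.algebraMap (B := E)),
    minpoly.algebraMap_eq (algebraMap L E).injective y]

lemma mahlerOver_algebraMap (x : K) :
    mahlerOver K (algebraMap K E x) = logHeight₁ x / Module.finrank ℚ K := by
  rw [mahlerOver_eq_logHeight₁_div, adjoin.finrank (Algebra.IsIntegral.isIntegral x),
    minpoly.eq_X_sub_C', Polynomial.natDegree_X_sub_C, Nat.cast_one, one_mul]

lemma mahlerOver_algebraMap_nonneg (x : K) : 0 ≤ mahlerOver K (algebraMap K E x) := by
  rw [mahlerOver_algebraMap]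
  exact div_nonneg (zero_le_logHeight₁ x) (Nat.cast_nonneg _)

lemma mahlerOver_nonneg (x : E) (hx : IsIntegral K x) : 0 ≤ mahlerOver K x := by
  have : FiniteDimensional K K⟮x⟯ := adjoin.finiteDimensional hx
  have : NumberField K⟮x⟯ :=
    { to_charZero := inferInstance, to_finiteDimensional := FiniteDimensional.trans ℚ K K⟮x⟯ }
  have h := mahlerOver_eq_logHeight₁_div (K := K) (E := E) (AdjoinSimple.gen K x)
  rw [AdjoinSimple.algebraMap_gen] at h
  rw [h]
  exact mul_nonneg (Nat.cast_nonneg _) (div_nonneg (zero_le_logHeight₁ _) (Nat.cast_nonneg _))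

/-- Taking norms down to `K` turns a factorization of `α` over `E` into one of a power of `α`
over `K`, with heights controlled by `mahlerOver`. -/
lemma exists_pow_eq_prod_norm {N : ℕ} {α : K} (hα : α ≠ 0) (a : Fin N → E)
    (ha : ∀ n, IsIntegral K (a n)) (h : algebraMap K E α = ∏ n, a n) :
    ∃ (D : ℕ) (e : Fin N → ℕ) (β : Fin N → K), D ≠ 0 ∧ (∀ n, e n ≤ D) ∧ (∀ n, β n ≠ 0) ∧
      α ^ D = ∏ n, β n ^ e n ∧
      ∀ n, mahlerOver K (algebraMap K E (β n)) ≤ mahlerOver K (a n) := by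
  let L := IntermediateField.adjoin K (Set.range a)
  have : FiniteDimensional K L :=
    finiteDimensional_adjoin (by rintro _ ⟨n, rfl⟩; exact ha n)
  let b : Fin N → L := fun n ↦ ⟨a n, subset_adjoin K _ ⟨n, rfl⟩⟩
  have hb : algebraMap K L α = ∏ n, b n := by
    apply (algebraMap L E).injective
    rw [map_prod, ← IsScalarTower.algebraMap_apply, h]
    rfl
  have hb0 (n : Fin N) : b n ≠ 0 := by
    have : ∏ n, b n ≠ 0 := by rw [← hb]; simpa using hα
    exact Finset.prod_ne_zero_iff.1 this n (Finset.mem_univ n)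
  -- The norm from `L` of `b n` is its norm from `K(b n)` to the power `[L : K(b n)]`.
  refine ⟨Module.finrank K L, fun n ↦ Module.finrank K⟮b n⟯ L,
    fun n ↦ Algebra.norm K (AdjoinSimple.gen K (b n)), Module.finrank_pos.ne', fun n ↦ ?_,
    fun n ↦ ?_, ?_, fun n ↦ ?_⟩
  · rw [← Module.finrank_mul_finrank K K⟮b n⟯ L]
    exact Nat.le_mul_of_pos_left _ Module.finrank_pos
  · rw [Algebra.norm_ne_zero_iff]
    intro h0
    apply hb0 n
    rw [← AdjoinSimple.algebraMap_gen K (b n), h0, map_zero]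
  · rw [← Algebra.norm_algebraMap, hb, map_prod]
    exact Finset.prod_congr rfl fun n _ ↦ Algebra.norm_eq_norm_adjoin K (b n)
  · have : NumberField K⟮b n⟯ :=
      { to_charZero := inferInstance
        to_finiteDimensional := FiniteDimensional.trans ℚ K K⟮b n⟯ }
    have hgen : algebraMap K⟮b n⟯ E (AdjoinSimple.gen K (b n)) = a n := by
      rw [IsScalarTower.algebraMap_apply K⟮b n⟯ L E, AdjoinSimple.algebraMap_gen]
      rfl
    have h1 := mahlerOver_eq_logHeight₁_div (K := K) (E := E) (AdjoinSimple.gen K (b n))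
    have h2 : Module.finrank K K⟮AdjoinSimple.gen K (b n)⟯ = Module.finrank K K⟮b n⟯ := by
      rw [adjoin.finrank (Algebra.IsIntegral.isIntegral _),
        adjoin.finrank (Algebra.IsIntegral.isIntegral _), minpoly_gen]
    rw [hgen, h2, ← Module.finrank_mul_finrank ℚ K K⟮b n⟯] at h1
    have hpos : (Module.finrank K K⟮b n⟯ : ℝ) ≠ 0 := by
      exact_mod_cast (Module.finrank_pos (R := K) (M := K⟮b n⟯)).ne'
    -- The degree in `m_K` cancels the one normalizing the absolute height, leaving what the norm
    -- inequality bounds.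
    have h3 : mahlerOver K (a n) =
        logHeight₁ (AdjoinSimple.gen K (b n)) / Module.finrank ℚ K := by
      rw [h1]
      push_cast
      field_simp
    rw [h3, mahlerOver_algebraMap]
    exact div_le_div_of_nonneg_right
      (Real.log_le_log (mulHeight₁_pos _) (mulHeight₁_norm_le _)) (Nat.cast_nonneg _)

end Basic

/-! ### Reduction to finitely many groupings. -/

section Attained

variable {K E : Type*} [Field K] [NumberField K] [Field E] [CharZero E] [Algebra K E]
  [Algebra.IsAlgebraic K E]

omit [NumberField K] [Algebra.IsAlgebraic K E] in
/-- Reindexing a factorization over an arbitrary finite nonempty type by `Fin N`. -/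
lemma exists_fin_factorization {κ : Type*} [Fintype κ] [Nonempty κ] {α : K} (γ : κ → K)
    (hγ : α = ∏ j, γ j) :
    ∃ N : ℕ, 0 < N ∧ ∃ a : Fin N → K, α = ∏ n, a n ∧
      (∀ t : ℝ, ∑ n, mahlerOver K (algebraMap K E (a n)) ^ t =
        ∑ j, mahlerOver K (algebraMap K E (γ j)) ^ t) ∧
      ⨆ n, mahlerOver K (algebraMap K E (a n)) = ⨆ j, mahlerOver K (algebraMap K E (γ j)) := by
  let ε := (Fintype.equivFin κ).symm
  exact ⟨Fintype.card κ, Fintype.card_pos, fun n ↦ γ (ε n), by rw [hγ, ε.prod_comp γ],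
    fun t ↦ ε.sum_comp fun j ↦ mahlerOver K (algebraMap K E (γ j)) ^ t,
    ε.iSup_comp (g := fun j ↦ mahlerOver K (algebraMap K E (γ j)))⟩

omit [Algebra.IsAlgebraic K E] in
lemma metricMahler_attained {κ : Type*} [Fintype κ] [Nonempty κ] {α : K} {t : ℝ} (ht : 0 < t)
    (γ : κ → K) (hγ : α = ∏ j, γ j)
    (h : ∀ (N : ℕ) (_ : 0 < N) (a : Fin N → E), algebraMap K E α = ∏ n, a n →
      ∑ j, mahlerOver K (algebraMap K E (γ j)) ^ t ≤ ∑ n, mahlerOver K (a n) ^ t) :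
    ∃ N : ℕ, 0 < N ∧ ∃ a : Fin N → K, α = ∏ n, a n ∧
      metricMahler K t (algebraMap K E α) ^ t =
        ∑ n, mahlerOver K (algebraMap K E (a n)) ^ t := by
  obtain ⟨N, hN, a, ha, hsum, -⟩ := exists_fin_factorization (E := E) γ hγ
  have h0 : 0 ≤ ∑ n, mahlerOver K (algebraMap K E (a n)) ^ t :=
    Finset.sum_nonneg fun n _ ↦ Real.rpow_nonneg (mahlerOver_algebraMap_nonneg _) _
  refine ⟨N, hN, a, ha, ?_⟩
  have hleast : metricMahler K t (algebraMap K E α) =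
      (∑ n, mahlerOver K (algebraMap K E (a n)) ^ t) ^ (1 / t) := by
    refine IsLeast.csInf_eq ⟨⟨N, hN, fun n ↦ algebraMap K E (a n), by rw [ha, map_prod], rfl⟩, ?_⟩
    rintro _ ⟨M, hM, b, hb, rfl⟩
    exact Real.rpow_le_rpow h0 ((hsum t).trans_le (h M hM b hb)) (by positivity)
  rw [hleast, ← Real.rpow_mul h0, one_div_mul_cancel ht.ne', Real.rpow_one]

omit [NumberField K] [Algebra.IsAlgebraic K E] in
lemma metricMahlerInf_attained {κ : Type*} [Fintype κ] [Nonempty κ] {α : K}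
    (γ : κ → K) (hγ : α = ∏ j, γ j)
    (h : ∀ (N : ℕ) (_ : 0 < N) (a : Fin N → E), algebraMap K E α = ∏ n, a n →
      ⨆ j, mahlerOver K (algebraMap K E (γ j)) ≤ ⨆ n, mahlerOver K (a n)) :
    ∃ N : ℕ, 0 < N ∧ ∃ a : Fin N → K, α = ∏ n, a n ∧
      metricMahlerInf K (algebraMap K E α) = ⨆ n, mahlerOver K (algebraMap K E (a n)) := by
  obtain ⟨N, hN, a, ha, -, hsup⟩ := exists_fin_factorization (E := E) γ hγ
  refine ⟨N, hN, a, ha,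
    IsLeast.csInf_eq ⟨⟨N, hN, fun n ↦ algebraMap K E (a n), by rw [ha, map_prod], rfl⟩, ?_⟩⟩
  rintro _ ⟨M, hM, b, hb, rfl⟩
  exact hsup.trans_le (h M hM b hb)

/-- The factorization of `u * ∏ i, x i` that groups the factors `x i` along `g`. -/
def groupedFactor {ι : Type*} [Fintype ι] [DecidableEq ι] (x : ι → K) (u : K) (g : ι → ι) :
    Option ι → K
  | none => u
  | some j => ∏ i with g i = j, x i

omit [NumberField K] in
lemma prod_groupedFactor {ι : Type*} [Fintype ι] [DecidableEq ι] (x : ι → K) (u : K) (g : ι → ι) :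
    ∏ j, groupedFactor x u g j = u * ∏ i, x i := by
  rw [Fintype.prod_option]
  simp only [groupedFactor]
  rw [Finset.prod_fiberwise]

/-- Distributions into `Fin N` are infinitely many as `N` varies; naming each fibre by a
representative turns them into self-maps of the fixed finite type `ι`. Injectivity of `F` on `s`
charges distinct groups to distinct `a n`. -/
lemma exists_groupedFactor_le [Subsingleton (InfinitePlace K)] [IsPrincipalIdealRing (𝓞 K)]
    {α : K} (hα : α ≠ 0) :
    ∃ (ι : Type) (_ : Fintype ι) (_ : DecidableEq ι) (x : ι → K) (u : K), α = u * ∏ i, x i ∧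
      ∀ (N : ℕ) (_ : 0 < N) (a : Fin N → E), algebraMap K E α = ∏ n, a n →
        ∃ (g : ι → ι) (s : Finset (Option ι)) (F : Option ι → Fin N), Set.InjOn F s ∧
          (∀ j ∈ s, mahlerOver K (algebraMap K E (groupedFactor x u g j)) ≤
            mahlerOver K (a (F j))) ∧
          ∀ j ∉ s, mahlerOver K (algebraMap K E (groupedFactor x u g j)) = 0 := by
  classical
  obtain ⟨ι, _, x, u, hx, hu, H⟩ := exists_factors_distributing hα
  refine ⟨ι, inferInstance, inferInstance, x, u, hx, fun N hN a ha ↦ ?_⟩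
  obtain ⟨D, e, β, hD, he, hβ, hpow, hle⟩ := exists_pow_eq_prod_norm hα a
    (fun n ↦ (Algebra.IsAlgebraic.isAlgebraic (a n)).isIntegral) ha
  obtain ⟨f, hf⟩ := H N hN β e D hD he hβ hpow
  obtain ⟨g, hg, hgf⟩ : ∃ g : ι → ι, (∀ i, f (g i) = f i) ∧ ∀ i k, f i = f k → g i = g k := by
    have hex (n : Set.range f) : ∃ k, f k = n := n.2
    choose c hc using hex
    exact ⟨fun i ↦ c ⟨f i, i, rfl⟩, fun i ↦ hc _, fun i k hik ↦ by simp only [hik]⟩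
  -- The set `s` holds the nonempty groups; the value at `none` is arbitrary, since the height-zero
  -- factor `u` lies outside `s`.
  refine ⟨g, Finset.univ.image fun i ↦ some (g i), fun j ↦ j.elim ⟨0, hN⟩ f, ?_, ?_, ?_⟩
  · intro j hj k hk hjk
    simp only [Finset.coe_image, Finset.coe_univ, Set.image_univ, Set.mem_range] at hj hk
    obtain ⟨i, rfl⟩ := hj
    obtain ⟨i', rfl⟩ := hk
    simp only [Option.elim_some, hg] at hjk
    rw [hgf _ _ hjk]
  · intro j hj
    obtain ⟨i, -, rfl⟩ := Finset.mem_image.1 hj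
    refine le_trans ?_ (hle _)
    rw [mahlerOver_algebraMap, mahlerOver_algebraMap]
    refine div_le_div_of_nonneg_right ?_ (Nat.cast_nonneg _)
    have hfilter : (Finset.univ.filter fun k ↦ g k = g i) = Finset.univ.filter fun k ↦ f k = f i :=
      Finset.filter_congr fun k _ ↦ ⟨fun h ↦ by rw [← hg k, h, hg], hgf k i⟩
    simp only [groupedFactor, Option.elim_some, hg, hfilter]
    exact hf (f i)
  · rintro (_ | j) hj
    · simp [mahlerOver_algebraMap, groupedFactor, hu]
    · have : (Finset.univ.filter fun k ↦ g k = j) = ∅ := by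
        rw [Finset.filter_eq_empty_iff]
        rintro k - rfl
        exact hj (Finset.mem_image_of_mem _ (Finset.mem_univ k))
      rw [mahlerOver_algebraMap]
      simp [groupedFactor, this]

theorem attained [Subsingleton (InfinitePlace K)] [IsPrincipalIdealRing (𝓞 K)] (α : K) :
    (∀ t : ℝ, 0 < t → ∃ N : ℕ, 0 < N ∧ ∃ a : Fin N → K, α = ∏ n, a n ∧
      metricMahler K t (algebraMap K E α) ^ t =
        ∑ n, mahlerOver K (algebraMap K E (a n)) ^ t) ∧
    (∃ N : ℕ, 0 < N ∧ ∃ a : Fin N → K, α = ∏ n, a n ∧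
      metricMahlerInf K (algebraMap K E α) = ⨆ n, mahlerOver K (algebraMap K E (a n))) := by
  have hnn (y : E) : 0 ≤ mahlerOver K y :=
    mahlerOver_nonneg y (Algebra.IsAlgebraic.isAlgebraic y).isIntegral
  -- Zero has no prime factorization, but the single factor `0` has measure `0`.
  obtain rfl | hα := eq_or_ne α 0
  · have h0 : mahlerOver K (algebraMap K E 0) = 0 := by
      rw [mahlerOver_algebraMap, logHeight₁_zero, zero_div]
    refine ⟨fun t ht ↦ metricMahler_attained ht (fun _ : Unit ↦ 0) (by simp) fun N _ a _ ↦ ?_,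
      metricMahlerInf_attained (fun _ : Unit ↦ 0) (by simp) fun N _ a _ ↦ ?_⟩
    · simp only [h0, Real.zero_rpow ht.ne', Finset.sum_const_zero]
      exact Finset.sum_nonneg fun n _ ↦ Real.rpow_nonneg (hnn _) _
    · simp only [h0, ciSup_const]
      exact Real.iSup_nonneg fun n ↦ hnn _
  obtain ⟨ι, _, _, x, u, hx, H⟩ := exists_groupedFactor_le (E := E) hα
  have : Nonempty (ι → ι) := ⟨id⟩
  refine ⟨fun t ht ↦ ?_, ?_⟩
  · obtain ⟨g₀, hg₀⟩ := Finite.exists_min fun g : ι → ι ↦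
      ∑ j, mahlerOver K (algebraMap K E (groupedFactor x u g j)) ^ t
    refine metricMahler_attained ht (groupedFactor x u g₀) (by rw [prod_groupedFactor, hx])
      fun N hN a ha ↦ ?_
    obtain ⟨g, s, F, hF, hle, hzero⟩ := H N hN a ha
    calc _ ≤ ∑ j, mahlerOver K (algebraMap K E (groupedFactor x u g j)) ^ t := hg₀ g
      _ = ∑ j ∈ s, mahlerOver K (algebraMap K E (groupedFactor x u g j)) ^ t := by
        refine (Finset.sum_subset (Finset.subset_univ s) fun j _ hj ↦ ?_).symm
        rw [hzero j hj, Real.zero_rpow ht.ne']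
      _ ≤ ∑ j ∈ s, mahlerOver K (a (F j)) ^ t :=
        Finset.sum_le_sum fun j hj ↦ Real.rpow_le_rpow (hnn _) (hle j hj) ht.le
      _ = ∑ n ∈ s.image F, mahlerOver K (a n) ^ t :=
        (Finset.sum_image (f := fun n ↦ mahlerOver K (a n) ^ t) hF).symm
      _ ≤ ∑ n, mahlerOver K (a n) ^ t :=
        Finset.sum_le_sum_of_subset_of_nonneg (Finset.subset_univ _)
          fun n _ _ ↦ Real.rpow_nonneg (hnn _) _
  · obtain ⟨g₀, hg₀⟩ := Finite.exists_min fun g : ι → ι ↦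
      ⨆ j, mahlerOver K (algebraMap K E (groupedFactor x u g j))
    refine metricMahlerInf_attained (groupedFactor x u g₀) (by rw [prod_groupedFactor, hx])
      fun N hN a ha ↦ ?_
    obtain ⟨g, s, F, hF, hle, hzero⟩ := H N hN a ha
    refine (hg₀ g).trans (ciSup_le fun j ↦ ?_)
    by_cases hj : j ∈ s
    · exact (hle j hj).trans (Finite.le_ciSup (fun n ↦ mahlerOver K (a n)) (F j))
    · rw [hzero j hj]
      exact Real.iSup_nonneg fun n ↦ hnn _

end Attained

/-! ### The hypotheses on `K`. -/

lemma subsingleton_infinitePlace {K : Type*} [Field K] [NumberField K]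
    (hK : Module.finrank ℚ K = 1 ∨ (Module.finrank ℚ K = 2 ∧ IsTotallyComplex K)) :
    Subsingleton (InfinitePlace K) := by
  rw [← Fintype.card_le_one_iff_subsingleton]
  have h := InfinitePlace.sum_mult_eq (K := K)
  obtain h1 | ⟨h2, hc⟩ := hK
  · rw [h1] at h
    rw [← h, ← Finset.card_univ, Finset.card_eq_sum_ones]
    exact Finset.sum_le_sum fun v _ ↦ v.mult_pos
  · rw [h2, Finset.sum_congr rfl fun v _ ↦ (hc.isComplex v).mult_eq_two, Finset.sum_const,
      Finset.card_univ, smul_eq_mul] at h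
    lia

lemma isPrincipalIdealRing_of_finrank_eq_one {K : Type*} [Field K] [NumberField K]
    (hK : Module.finrank ℚ K = 1) : IsPrincipalIdealRing (𝓞 K) := by
  have hbij : Function.Bijective (algebraMap ℚ K) :=
    bijective_algebraMap_of_linearEquiv (LinearEquiv.ofFinrankEq ℚ K (by simp [hK]))
  let ε := Rat.ringOfIntegersEquiv.symm.trans
    (RingOfIntegers.mapRingEquiv (RingEquiv.ofBijective (algebraMap ℚ K) hbij))
  exact IsPrincipalIdealRing.of_surjective ε ε.surjective

end MetricMahler

theorem corollary1p3 {K Qbar : Type*} [Field K] [NumberField K]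
    [Field Qbar] [CharZero Qbar] [IsAlgClosure ℚ Qbar] [Algebra K Qbar]
    (hK : Module.finrank ℚ K = 1 ∨
      (Module.finrank ℚ K = 2 ∧ NumberField.IsTotallyComplex K ∧ NumberField.classNumber K = 1))
    (α : K) :
    (∀ t : ℝ, 0 < t → ∃ N : ℕ, 0 < N ∧ ∃ a : Fin N → K, α = ∏ n, a n ∧
      MetricMahler.metricMahler K t (algebraMap K Qbar α) ^ t =
        ∑ n, MetricMahler.mahlerOver K (algebraMap K Qbar (a n)) ^ t) ∧
    (∃ N : ℕ, 0 < N ∧ ∃ a : Fin N → K, α = ∏ n, a n ∧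
      MetricMahler.metricMahlerInf K (algebraMap K Qbar α) =
        ⨆ n, MetricMahler.mahlerOver K (algebraMap K Qbar (a n))) := by
  have : Subsingleton (InfinitePlace K) :=
    MetricMahler.subsingleton_infinitePlace (hK.imp_right fun h ↦ ⟨h.1, h.2.1⟩)
  have : IsPrincipalIdealRing (𝓞 K) := hK.elim
    MetricMahler.isPrincipalIdealRing_of_finrank_eq_one fun h ↦ classNumber_eq_one_iff.1 h.2.2
  have : Algebra.IsAlgebraic ℚ Qbar := IsAlgClosure.isAlgebraic
  have : Algebra.IsAlgebraic K Qbar := Algebra.IsAlgebraic.tower_top (K := ℚ) K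
  exact MetricMahler.attained α
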